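/- Let $n\ge 1$ and $0\le k\le n$. Let $\mathcal W_n$ be the Weyl group of type $B_n$, realized as the group of permutations $w$ of $\{-n,\dots,-1,0,1,\dots,n\}$ with $w(-i)=-w(i)$ for all $i$, and write $w$ in one-line notation $w(1)\cdots w(n)$, with $\bar a=-a$. It is generated by $s_0=(\bar 1,1)$ and $s_i=(\overline{i+1},\bar i)(i,i+1)$ for $1\le i\le n-1$, where $(ws_i)(j)=w(s_i(j))$. Let $\ell(w)$ be the minimal number of factors in an expression of $w$ as a product of the $s_i$. In the Bruhat order, $w'\le w$ means that $w'$ is the product of a subword of a reduced decomposition of $w$, and $w$ covers $w'$ means that $w'\le w$ and $\ell(w)=\ell(w')+1$. Let $$\mathcal W_n^{(k)}=\{w\in\mathcal W_n : \ell(w)<\ell(ws_i)\text{ for all } 0\le i\le n-1,\ i\ne k\}$$ be the set of signed $k$-Grassmannian permutations. Its elements are written $$w=u_1\cdots u_k\,|\,\overline{\lambda_r}\cdots\overline{\lambda_1}\,v_1\cdots v_{n-k-r},$$ with $0<u_1<\dots<u_k$, $0<\lambda_1<\dots<\lambda_r$ and $0<v_1<\dots<v_{n-k-r}$. **Theorem.**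 Let $w,w'\in\mathcal W_n^{(k)}$, with $u,\lambda,v$ as above for $w$. Then $w$ covers $w'$ if and only if the one-line notation of $w'$ is obtained from that of $w$ by one of the following changes, all other entries keeping their values and positions: * (B1) $\lambda_1=1$, and the entry $\bar 1$ of $w$ is replaced by $1$; * (B2) for some $a$, $t$, $q$ with $\lambda_t=a$ and $v_q=a-1$, the entry $\bar a$ is replaced by $\overline{a-1}$ and the entry $a-1$ in the position of $v_q$ is replaced by $a$; * (B3) for some integers $a>x>0$ and some $p$, $q$ with $u_p=a$ and $v_q=a-x$, the entries $u_p$ and $v_q$ are exchanged; * (B4) for some integers $a>x>0$ and some $p$, $t$ with $u_p=a-x$ and $\lambda_t=a$, the entry $u_p$ is replaced by $a$ and the entry $\bar a$ is replaced by $\overline{a-x}$. -/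

import Mathlib

/-- The hyperoctahedral group (Weyl group of type `B_n`): the barred permutations `w` of
`-n, …, -1, 0, 1, …, n` with `w (-i) = -w i`. A permutation of `{-n, …, n}` is represented by
its extension to `ℤ` that fixes every integer outside `{-n, …, n}`. -/
def hyperoctahedral (n : ℕ) : Subgroup (Equiv.Perm ℤ) where
  carrier := {w | (∀ i, w (-i) = -w i) ∧ ∀ i, (n : ℤ) < |i| → w i = i}
  one_mem' := ⟨fun _ => rfl, fun _ _ => rfl⟩
  mul_mem' := by
    rintro a b ⟨ha, ha'⟩ ⟨hb, hb'⟩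
    refine ⟨fun i => ?_, fun i hi => ?_⟩
    · rw [Equiv.Perm.mul_apply, Equiv.Perm.mul_apply, hb, ha]
    · rw [Equiv.Perm.mul_apply, hb' i hi, ha' i hi]
  inv_mem' := by
    rintro a ⟨ha, ha'⟩
    refine ⟨fun i => ?_, fun i hi => ?_⟩
    · rw [Equiv.Perm.inv_eq_iff_eq, ha, ← Equiv.Perm.mul_apply, mul_inv_cancel, Equiv.Perm.one_apply]
    · rw [Equiv.Perm.inv_eq_iff_eq, ha' i hi]

/-- The one-line notation of `w` is `w 1, w 2, …, w n`. -/
instance (n : ℕ) : CoeFun (hyperoctahedral n) (fun _ => ℤ → ℤ) := ⟨fun w => w.1⟩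

/-- The permutations underlying the simple reflections: `s_0 = (-1, 1)` and
`s_i = (-(i+1), -i) (i, i+1)` for `i ≥ 1`. -/
def simplePerm (i : ℕ) : Equiv.Perm ℤ :=
  if i = 0 then Equiv.swap (-1) 1
  else Equiv.swap (-((i : ℤ) + 1)) (-(i : ℤ)) * Equiv.swap (i : ℤ) ((i : ℤ) + 1)

theorem simplePerm_mem {n i : ℕ} (hi : i < n) : simplePerm i ∈ hyperoctahedral n := by
  refine ⟨fun j => ?_, fun j hj => ?_⟩
  · unfold simplePerm
    split_ifs with h
    · simp only [Equiv.swap_apply_def]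
      split_ifs <;> omega
    · simp only [Equiv.Perm.mul_apply, Equiv.swap_apply_def]
      split_ifs <;> omega
  · rw [lt_abs] at hj
    unfold simplePerm
    split_ifs with h
    · simp only [Equiv.swap_apply_def]
      split_ifs <;> omega
    · simp only [Equiv.Perm.mul_apply, Equiv.swap_apply_def]
      split_ifs <;> omega

/-- The simple reflections `s_0, …, s_{n-1}`. Right multiplication `w * s_0` changes the sign of
the first entry of the one-line notation of `w`, and `w * s_i` (`i ≥ 1`) exchanges the entries in
positions `i` and `i + 1`. -/
def simpleReflection {n : ℕ} (i : Fin n) : hyperoctahedral n :=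
  ⟨simplePerm i, simplePerm_mem i.2⟩

/-- The product `s_{i_1} ⋯ s_{i_m}` of a word `i_1, …, i_m`. -/
def wordProd {n : ℕ} (ω : List (Fin n)) : hyperoctahedral n :=
  (ω.map simpleReflection).prod

/-- The length of `w`: the minimal number of simple reflections in a decomposition of `w`. -/
noncomputable def signedLength {n : ℕ} (w : hyperoctahedral n) : ℕ :=
  sInf {m | ∃ ω : List (Fin n), ω.length = m ∧ wordProd ω = w}

/-- `ω` is a reduced decomposition of `w`. -/
def IsReducedWordOf {n : ℕ} (ω : List (Fin n)) (w : hyperoctahedral n) : Prop :=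
  wordProd ω = w ∧ ω.length = signedLength w

/-- The Bruhat order, through the subword property: `w' ≤ w` if `w'` is the product of a subword
of a reduced decomposition of `w`. -/
def BruhatLE {n : ℕ} (w' w : hyperoctahedral n) : Prop :=
  ∃ ω : List (Fin n), IsReducedWordOf ω w ∧ ∃ ω' : List (Fin n), ω'.Sublist ω ∧ wordProd ω' = w'

/-- `w` covers `w'` in the Bruhat order. -/
def BruhatCovers {n : ℕ} (w w' : hyperoctahedral n) : Prop :=
  BruhatLE w' w ∧ signedLength w = signedLength w' + 1

/-- The signed `k`-Grassmannian permutations: the minimal length representatives of the cosets of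
the parabolic subgroup generated by all `s_i` with `i ≠ k`. In one-line notation they read
`u_1 ⋯ u_k | -λ_r ⋯ -λ_1 v_1 ⋯ v_{n-k-r}` with all of `u`, `λ`, `v` positive and increasing:
the `u`'s are the entries in the positions `1, …, k`; the `-λ`'s are the negative entries and the
`v`'s the positive entries in the positions `k + 1, …, n`. -/
def grassmannianPerms (n k : ℕ) : Set (hyperoctahedral n) :=
  {w | ∀ i : Fin n, (i : ℕ) ≠ k → signedLength w < signedLength (w * simpleReflection i)}

/-- Type B1: `w = ⋯ | ⋯ -1 ⋯` and `w' = ⋯ | ⋯ 1 ⋯`, all other entries being equal. -/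
def IsTypeB1 {n : ℕ} (k : ℕ) (w w' : hyperoctahedral n) : Prop :=
  ∃ j ∈ Set.Icc ((k : ℤ) + 1) n, w j = -1 ∧ w' j = 1 ∧
    ∀ m ∈ Set.Icc (1 : ℤ) n, m ≠ j → w' m = w m

/-- Type B2: `w = ⋯ | ⋯ -a ⋯ (a-1) ⋯` and `w' = ⋯ | ⋯ -(a-1) ⋯ a ⋯`, all other entries being
equal. Here `a - 1` is one of the `v`'s, hence positive. -/
def IsTypeB2 {n : ℕ} (k : ℕ) (w w' : hyperoctahedral n) : Prop :=
  ∃ a : ℤ, 0 < a - 1 ∧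
  ∃ i ∈ Set.Icc ((k : ℤ) + 1) n, ∃ j ∈ Set.Icc ((k : ℤ) + 1) n, i < j ∧
    w i = -a ∧ w j = a - 1 ∧ w' i = -(a - 1) ∧ w' j = a ∧
    ∀ m ∈ Set.Icc (1 : ℤ) n, m ≠ i → m ≠ j → w' m = w m

/-- Type B3: `w = ⋯ a ⋯ | ⋯ (a-x) ⋯` and `w' = ⋯ (a-x) ⋯ | ⋯ a ⋯` with `a > x > 0`, all other
entries being equal. -/
def IsTypeB3 {n : ℕ} (k : ℕ) (w w' : hyperoctahedral n) : Prop :=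
  ∃ a x : ℤ, 0 < x ∧ x < a ∧
  ∃ i ∈ Set.Icc (1 : ℤ) k, ∃ j ∈ Set.Icc ((k : ℤ) + 1) n,
    w i = a ∧ w j = a - x ∧ w' i = a - x ∧ w' j = a ∧
    ∀ m ∈ Set.Icc (1 : ℤ) n, m ≠ i → m ≠ j → w' m = w m

/-- Type B4: `w = ⋯ (a-x) ⋯ | ⋯ -a ⋯` and `w' = ⋯ a ⋯ | ⋯ -(a-x) ⋯` with `a > x > 0`, all other
entries being equal. -/
def IsTypeB4 {n : ℕ} (k : ℕ) (w w' : hyperoctahedral n) : Prop :=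
  ∃ a x : ℤ, 0 < x ∧ x < a ∧
  ∃ i ∈ Set.Icc (1 : ℤ) k, ∃ j ∈ Set.Icc ((k : ℤ) + 1) n,
    w i = a - x ∧ w j = -a ∧ w' i = a ∧ w' j = -(a - x) ∧
    ∀ m ∈ Set.Icc (1 : ℤ) n, m ≠ i → m ≠ j → w' m = w m

/-! Every reflection of type B is a signed swap of two nonzero positions `i` and `j`, taken with
signs; `i = -j` is a sign change. Strong exchange says that a signed swap removing an inversion (`i
< j`, `w j < w i`) deletes one letter from any word for `w`, so it strictly lowers the length
(`signedLength_lt_of_isSignedSwap`) and goes down in Bruhat order. Conversely, in a cover the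
subword omits exactly one letter, so the two elements differ by a reflection.

For "if", the changes (B1)–(B4) are inversion-removing swaps, and it remains to see that the length
drops by at most one. For (B1) the swap is left multiplication by `s_0`. For the others,
`signedLength_le_of_isSignedSwap` applies when no intermediate value sits between the two positions;
this is automatic for adjacent values, and otherwise follows from the monotonicity of the two blocks
and the positivity of the first.

For "only if", monotonicity and positivity in `w` and `w'` restrict which reflection can occur. When
the values are not those of (B1) or (B2), the reflection factors into three signed swaps, each
removing an inversion, so the length drops by at least three. -/

namespace hyperoctahedral

/-! ### Signed permutations and reflections -/

variable {n : ℕ}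

theorem apply_neg (w : hyperoctahedral n) (i : ℤ) : w (-i) = -w i := w.2.1 i

theorem apply_of_lt_abs (w : hyperoctahedral n) {i : ℤ} (hi : (n : ℤ) < |i|) : w i = i := w.2.2 i hi

theorem apply_inj (w : hyperoctahedral n) {i j : ℤ} : w i = w j ↔ i = j := w.1.injective.eq_iff

theorem apply_zero (w : hyperoctahedral n) : w 0 = 0 := by
  have := apply_neg w 0
  rw [neg_zero] at this
  omega

theorem apply_ne_zero (w : hyperoctahedral n) {i : ℤ} (hi : i ≠ 0) : w i ≠ 0 := by
  intro h
  exact hi ((apply_inj w).1 (h.trans (apply_zero w).symm))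

theorem mul_apply (v w : hyperoctahedral n) (i : ℤ) : (v * w) i = v (w i) := rfl

theorem abs_apply_le (w : hyperoctahedral n) {i : ℤ} (hi : |i| ≤ n) : |w i| ≤ n := by
  by_contra! h
  have := (apply_inj w).1 (apply_of_lt_abs w h)
  rw [this] at h
  omega

theorem exists_apply_eq (w : hyperoctahedral n) {a : ℤ} (ha : |a| ≤ n) : ∃ i : ℤ, |i| ≤ n ∧ w i = a := by
  obtain ⟨i, hi⟩ := w.1.surjective a
  refine ⟨i, ?_, hi⟩
  by_contra! h
  have := apply_of_lt_abs w h
  rw [hi] at this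
  rw [this] at ha
  omega

theorem ext_apply {v w : hyperoctahedral n} (h : ∀ i, v i = w i) : v = w :=
  Subtype.ext (Equiv.ext h)

theorem ext_of_eqOn {v w : hyperoctahedral n} (h : ∀ i ∈ Set.Icc (1 : ℤ) n, v i = w i) : v = w := by
  refine ext_apply fun i => ?_
  rcases lt_or_ge (n : ℤ) |i| with hi | hi
  · rw [apply_of_lt_abs v hi, apply_of_lt_abs w hi]
  · rw [abs_le] at hi
    rcases lt_trichotomy i 0 with h0 | h0 | h0
    · have := h (-i) ⟨by omega, by omega⟩
      rw [apply_neg, apply_neg] at this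
      omega
    · rw [h0, apply_zero, apply_zero]
    · exact h i ⟨by omega, by omega⟩

/-- `w'` arises from `w` by exchanging the entries in positions `i` and `j`, and those in positions
`-i` and `-j`. -/
structure IsSignedSwap (w w' : hyperoctahedral n) (i j : ℤ) : Prop where
  left : w' i = w j
  right : w' j = w i
  other : ∀ m, m ≠ i → m ≠ -i → m ≠ j → m ≠ -j → w' m = w m

namespace IsSignedSwap

variable {w w' : hyperoctahedral n} {i j : ℤ}

theorem symm (h : IsSignedSwap w w' i j) : IsSignedSwap w' w i j :=
  ⟨h.right.symm, h.left.symm, fun m h1 h2 h3 h4 => (h.other m h1 h2 h3 h4).symm⟩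

theorem comm (h : IsSignedSwap w w' i j) : IsSignedSwap w w' j i :=
  ⟨h.right, h.left, fun m h1 h2 h3 h4 => h.other m h3 h4 h1 h2⟩

theorem neg (h : IsSignedSwap w w' i j) : IsSignedSwap w w' (-i) (-j) := by
  refine ⟨?_, ?_, fun m h1 h2 h3 h4 => h.other m ?_ h1 ?_ h3⟩
  · rw [apply_neg, apply_neg, h.left]
  · rw [apply_neg, apply_neg, h.right]
  · rwa [neg_neg] at h2
  · rwa [neg_neg] at h4

theorem mul_left (h : IsSignedSwap w w' i j) (g : hyperoctahedral n) :
    IsSignedSwap (g * w) (g * w') i j := by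
  refine ⟨?_, ?_, fun m h1 h2 h3 h4 => ?_⟩
  · rw [mul_apply, mul_apply, h.left]
  · rw [mul_apply, mul_apply, h.right]
  · rw [mul_apply, mul_apply, h.other m h1 h2 h3 h4]

/-- Right multiplication acts on positions, so the reflection is conjugated and its positions are
pulled back along `g`. -/
theorem mul_right {g : hyperoctahedral n} (h : IsSignedSwap w w' (g i) (g j)) :
    IsSignedSwap (w * g) (w' * g) i j := by
  refine ⟨h.left, h.right, fun m h1 h2 h3 h4 => h.other (g m) ?_ ?_ ?_ ?_⟩
  · rwa [Ne, apply_inj]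
  · rwa [← apply_neg, Ne, apply_inj]
  · rwa [Ne, apply_inj]
  · rwa [← apply_neg, Ne, apply_inj]

theorem unique {w'' : hyperoctahedral n} (h : IsSignedSwap w w' i j) (h' : IsSignedSwap w w'' i j) :
    w' = w'' := by
  refine ext_apply fun m => ?_
  by_cases h1 : m = i
  · rw [h1, h.left, h'.left]
  by_cases h2 : m = -i
  · rw [h2, apply_neg, apply_neg, h.left, h'.left]
  by_cases h3 : m = j
  · rw [h3, h.right, h'.right]
  by_cases h4 : m = -j
  · rw [h4, apply_neg, apply_neg, h.right, h'.right]
  rw [h.other m h1 h2 h3 h4, h'.other m h1 h2 h3 h4]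

theorem of_eqOn (hl : w' i = w j) (hr : w' j = w i)
    (h : ∀ m ∈ Set.Icc (1 : ℤ) n, m ≠ |i| → m ≠ |j| → w' m = w m) : IsSignedSwap w w' i j := by
  refine ⟨hl, hr, fun m h1 h2 h3 h4 => ?_⟩
  rcases lt_or_ge (n : ℤ) |m| with hm | hm
  · rw [apply_of_lt_abs w hm, apply_of_lt_abs w' hm]
  · rw [abs_le] at hm
    have hi := abs_choice i
    have hj := abs_choice j
    rcases lt_trichotomy m 0 with h0 | h0 | h0
    · have := h (-m) ⟨by omega, by omega⟩ (by omega) (by omega)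
      rw [apply_neg, apply_neg] at this
      omega
    · rw [h0, apply_zero, apply_zero]
    · exact h m ⟨by omega, by omega⟩ (by omega) (by omega)

end IsSignedSwap

theorem exists_isSignedSwap (w : hyperoctahedral n) {i j : ℤ} (hi : |i| ≤ n) (hj : |j| ≤ n)
    (hi0 : i ≠ 0) (hj0 : j ≠ 0) : ∃ w', IsSignedSwap w w' i j := by
  rw [abs_le] at hi hj
  by_cases hij : i = -j
  · have ht : Equiv.swap i j ∈ hyperoctahedral n := by
      refine ⟨fun m => ?_, fun m hm => ?_⟩
      · simp only [Equiv.swap_apply_def]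
        split_ifs <;> omega
      · rw [lt_abs] at hm
        simp only [Equiv.swap_apply_def]
        split_ifs <;> omega
    refine ⟨w * ⟨_, ht⟩, ?_, ?_, fun m h1 h2 h3 h4 => ?_⟩ <;> rw [mul_apply]
    · simp
    · simp
    · simp [Equiv.swap_apply_of_ne_of_ne h1 h3]
  by_cases hij' : i = j
  · exact ⟨w, by rw [hij'], by rw [hij'], fun _ _ _ _ _ => rfl⟩
  · have ht : Equiv.swap i j * Equiv.swap (-i) (-j) ∈ hyperoctahedral n := by
      refine ⟨fun m => ?_, fun m hm => ?_⟩
      · simp only [Equiv.Perm.mul_apply, Equiv.swap_apply_def]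
        split_ifs <;> omega
      · rw [lt_abs] at hm
        simp only [Equiv.Perm.mul_apply, Equiv.swap_apply_def]
        split_ifs <;> omega
    refine ⟨w * ⟨_, ht⟩, ?_, ?_, fun m h1 h2 h3 h4 => ?_⟩ <;> rw [mul_apply, apply_inj] <;>
      simp only [Equiv.Perm.mul_apply, Equiv.swap_apply_def] <;> split_ifs <;> omega

end hyperoctahedral

open hyperoctahedral

/-! ### Simple reflections acting on positions (right) and on values (left) -/

section SimpleReflection

variable {n : ℕ}

theorem simpleReflection_zero_apply {i : Fin n} (hi : (i : ℕ) = 0) (m : ℤ) :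
    (simpleReflection i) m = if m = -1 then 1 else if m = 1 then -1 else m := by
  change simplePerm i m = _
  simp only [simplePerm, hi, if_true, Equiv.swap_apply_def]

theorem simpleReflection_pos_apply {i : Fin n} (hi : (i : ℕ) ≠ 0) (m : ℤ) :
    (simpleReflection i) m = if m = i then (i : ℤ) + 1 else if m = (i : ℤ) + 1 then (i : ℤ) else
      if m = -(i : ℤ) then -((i : ℤ) + 1) else if m = -((i : ℤ) + 1) then -(i : ℤ) else m := by
  change simplePerm i m = _
  simp only [simplePerm, hi, if_false, Equiv.Perm.mul_apply, Equiv.swap_apply_def]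
  split_ifs <;> omega

theorem simpleReflection_apply_apply (i : Fin n) (m : ℤ) :
    (simpleReflection i) ((simpleReflection i) m) = m := by
  by_cases hi : (i : ℕ) = 0
  · rw [simpleReflection_zero_apply hi m]
    split_ifs <;> rw [simpleReflection_zero_apply hi] <;> split_ifs <;> first | omega | contradiction
  · simp only [simpleReflection_pos_apply hi]
    split_ifs <;> omega

theorem simpleReflection_mul_self (i : Fin n) : simpleReflection i * simpleReflection i = 1 :=
  ext_apply (simpleReflection_apply_apply i)

theorem isSignedSwap_mul_simpleReflection_zero (w : hyperoctahedral n) {i : Fin n}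
    (hi : (i : ℕ) = 0) : IsSignedSwap w (w * simpleReflection i) (-1) 1 := by
  refine ⟨?_, ?_, fun m h1 h2 h3 h4 => ?_⟩ <;>
    rw [mul_apply, apply_inj, simpleReflection_zero_apply hi] <;> split_ifs <;> omega

theorem isSignedSwap_mul_simpleReflection_pos (w : hyperoctahedral n) {i : Fin n}
    (hi : (i : ℕ) ≠ 0) : IsSignedSwap w (w * simpleReflection i) i (i + 1) := by
  refine ⟨?_, ?_, fun m h1 h2 h3 h4 => ?_⟩ <;>
    rw [mul_apply, apply_inj, simpleReflection_pos_apply hi] <;> split_ifs <;> omega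

theorem isSignedSwap_simpleReflection_zero_mul {w : hyperoctahedral n} {i : Fin n}
    (hi : (i : ℕ) = 0) {p : ℤ} (hp : w p = 1) :
    IsSignedSwap w (simpleReflection i * w) p (-p) := by
  refine ⟨?_, ?_, fun m h1 h2 h3 h4 => ?_⟩
  · rw [mul_apply, apply_neg, hp, simpleReflection_zero_apply hi]; rfl
  · rw [mul_apply, apply_neg, hp, simpleReflection_zero_apply hi]; rfl
  · have h5 : w m ≠ 1 := by rwa [← hp, Ne, apply_inj]
    have h6 : w m ≠ -1 := by rwa [← hp, ← apply_neg, Ne, apply_inj]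
    rw [mul_apply, simpleReflection_zero_apply hi, if_neg h6, if_neg h5]

theorem isSignedSwap_simpleReflection_pos_mul {w : hyperoctahedral n} {i : Fin n}
    (hi : (i : ℕ) ≠ 0) {p q : ℤ} (hp : w p = i) (hq : w q = i + 1) :
    IsSignedSwap w (simpleReflection i * w) p q := by
  refine ⟨?_, ?_, fun m h1 h2 h3 h4 => ?_⟩
  · rw [mul_apply, hp, hq, simpleReflection_pos_apply hi, if_pos rfl]
  · rw [mul_apply, hp, hq, simpleReflection_pos_apply hi, if_neg (by omega), if_pos rfl]
  · have h5 : w m ≠ i := by rwa [← hp, Ne, apply_inj]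
    have h6 : w m ≠ -i := by rwa [← hp, ← apply_neg, Ne, apply_inj]
    have h7 : w m ≠ i + 1 := by rwa [← hq, Ne, apply_inj]
    have h8 : w m ≠ -(i + 1) := by rwa [← hq, ← apply_neg, Ne, apply_inj]
    rw [mul_apply, simpleReflection_pos_apply hi, if_neg h5, if_neg h7, if_neg h6, if_neg h8]

/-- The only pairs of nonzero integers whose order is reversed by a simple reflection are those
that it exchanges. -/
theorem isSignedSwap_of_simpleReflection_lt (w : hyperoctahedral n) (s : Fin n) {i j : ℤ}
    (hij : i < j) (hi : i ≠ 0) (hj : j ≠ 0) (h : (simpleReflection s) j < (simpleReflection s) i) :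
    IsSignedSwap w (w * simpleReflection s) i j := by
  by_cases hs : (s : ℕ) = 0
  · rw [simpleReflection_zero_apply hs, simpleReflection_zero_apply hs] at h
    have : i = -1 ∧ j = 1 := by split_ifs at h <;> omega
    rw [this.1, this.2]
    exact isSignedSwap_mul_simpleReflection_zero w hs
  · rw [simpleReflection_pos_apply hs, simpleReflection_pos_apply hs] at h
    have : (i = s ∧ j = s + 1) ∨ (i = -(s + 1) ∧ j = -s) := by split_ifs at h <;> omega
    rcases this with h' | h' <;> rw [h'.1, h'.2]
    · exact isSignedSwap_mul_simpleReflection_pos w hs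
    · exact (isSignedSwap_mul_simpleReflection_pos w hs).neg.comm

end SimpleReflection

/-! ### Words, strong exchange and length -/

section Word

variable {n : ℕ}

theorem wordProd_nil : wordProd ([] : List (Fin n)) = 1 := rfl

theorem wordProd_append (ω ω' : List (Fin n)) : wordProd (ω ++ ω') = wordProd ω * wordProd ω' := by
  simp [wordProd]

theorem wordProd_singleton (s : Fin n) : wordProd [s] = simpleReflection s := by
  simp [wordProd]

/-- The strong exchange property. -/
theorem exists_sublist_of_isSignedSwap (ω : List (Fin n)) {w' : hyperoctahedral n} {i j : ℤ}
    (hij : i < j) (hi : i ≠ 0) (hj : j ≠ 0) (h : IsSignedSwap (wordProd ω) w' i j)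
    (hinv : (wordProd ω) j < (wordProd ω) i) :
    ∃ ω' : List (Fin n), ω'.Sublist ω ∧ ω'.length + 1 = ω.length ∧ wordProd ω' = w' := by
  induction ω using List.reverseRecOn generalizing w' i j with
  | nil => exact absurd hinv (by rw [wordProd_nil]; exact hij.not_gt)
  | append_singleton ω s ih =>
    rw [wordProd_append, wordProd_singleton] at h hinv
    rcases lt_trichotomy ((simpleReflection s) i) ((simpleReflection s) j) with hs | hs | hs
    -- The last letter keeps the order of `i` and `j`, so the inversion already exists in the
    -- shorter word, at the images of these positions.
    · have h2 : IsSignedSwap (wordProd ω) (w' * simpleReflection s)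
          ((simpleReflection s) i) ((simpleReflection s) j) := by
        have h3 : IsSignedSwap (wordProd ω * simpleReflection s) w'
            ((simpleReflection s) ((simpleReflection s) i))
            ((simpleReflection s) ((simpleReflection s) j)) := by
          rwa [simpleReflection_apply_apply, simpleReflection_apply_apply]
        have h4 := h3.mul_right
        rwa [mul_assoc, simpleReflection_mul_self, mul_one] at h4
      obtain ⟨ω', hsub, hlen, hprod⟩ := ih hs (apply_ne_zero _ hi) (apply_ne_zero _ hj) h2 hinv
      refine ⟨ω' ++ [s], hsub.append (List.Sublist.refl _), by simp [hlen], ?_⟩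
      rw [wordProd_append, wordProd_singleton, hprod, mul_assoc, simpleReflection_mul_self, mul_one]
    · exact absurd ((apply_inj _).1 hs) hij.ne
    -- The last letter reverses `i` and `j`, so it is itself the reflection: delete it.
    · refine ⟨ω, List.sublist_append_left _ _, by simp, ?_⟩
      have h2 := isSignedSwap_of_simpleReflection_lt (wordProd ω * simpleReflection s) s hij hi hj hs
      rw [mul_assoc, simpleReflection_mul_self, mul_one] at h2
      exact h2.unique h

/-- Integer values that start at least at 1, grow by at least 1 at each step and end at most at `n`
leave no slack. -/
theorem eq_one_of_monotone (w : hyperoctahedral n)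
    (h : ∀ i : Fin n, ((i : ℕ) = 0 → 0 < w 1) ∧ ((i : ℕ) ≠ 0 → w i < w (i + 1))) : w = 1 := by
  have step : ∀ i : ℕ, 1 ≤ i → i < n → w i < w (i + 1) := fun i h1 h2 =>
    (h ⟨i, h2⟩).2 (by simp only; omega)
  have mono : ∀ i d : ℕ, 1 ≤ i → i + d ≤ n → w i + d ≤ w (i + d : ℤ) := by
    intro i d hi
    induction d with
    | zero => simp
    | succ d ih =>
      intro hd
      have h1 := ih (by omega)
      have h2 := step (i + d) (by omega) (by omega)
      push_cast at h2 ⊢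
      rw [← add_assoc (i : ℤ)]
      omega
  refine ext_of_eqOn fun i hi => ?_
  obtain ⟨m, rfl⟩ := Int.eq_ofNat_of_zero_le (show 0 ≤ i by have := hi.1; omega)
  have h1 : 1 ≤ m := by have := hi.1; omega
  have h2 : m ≤ n := by have := hi.2; omega
  have hpos : 0 < w 1 := (h ⟨0, by omega⟩).1 rfl
  have h3 := mono 1 (m - 1) le_rfl (by omega)
  have h4 := mono m (n - m) h1 (by omega)
  have h5 := abs_le.1 (abs_apply_le w (i := n) (by simp))
  rw [Nat.cast_sub h1] at h3
  rw [Nat.cast_sub h2] at h4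
  have e1 : ((1 : ℕ) : ℤ) + ((m : ℤ) - ((1 : ℕ) : ℤ)) = m := by omega
  have e2 : (m : ℤ) + ((n : ℤ) - (m : ℤ)) = n := by omega
  rw [e1] at h3
  rw [e2] at h4
  change w m = (m : ℤ)
  push_cast at h3
  omega

/-- Sorting terminates: removing a descent by a simple reflection increases the bounded sum `∑ j * w
j`, and only the identity has no descent. This ensures that the infimum defining `signedLength` is
attained. -/
theorem exists_wordProd_eq (w : hyperoctahedral n) : ∃ ω : List (Fin n), wordProd ω = w := by
  let M : hyperoctahedral n → ℤ := fun v => ∑ j ∈ Finset.Icc (1 : ℤ) n, j * v j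
  have hM : ∀ v, M v ≤ ∑ j ∈ Finset.Icc (1 : ℤ) n, j * (n : ℤ) := by
    intro v
    refine Finset.sum_le_sum fun j hj => ?_
    rw [Finset.mem_Icc] at hj
    have := abs_le.1 (abs_apply_le v (i := j) (by rw [abs_le]; omega))
    exact mul_le_mul_of_nonneg_left this.2 (by omega)
  generalize (∑ j ∈ Finset.Icc (1 : ℤ) n, j * (n : ℤ)) = C at hM
  obtain ⟨d, hd⟩ : ∃ d : ℕ, C - M w < d := ⟨(C - M w).toNat + 1, by have := hM w; omega⟩
  induction d generalizing w with
  | zero => have := hM w; simp at hd; omega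
  | succ d ih =>
    by_cases hw : ∀ i : Fin n, ((i : ℕ) = 0 → 0 < w 1) ∧ ((i : ℕ) ≠ 0 → w i < w (i + 1))
    · exact ⟨[], (eq_one_of_monotone w hw).symm⟩
    have hstep : ∃ s : Fin n, M w < M (w * simpleReflection s) := by
      push Not at hw
      obtain ⟨s, hs⟩ := hw
      have hsn := s.2
      refine ⟨s, ?_⟩
      rw [← sub_pos]
      simp only [M]
      rw [← Finset.sum_sub_distrib]
      by_cases hs0 : (s : ℕ) = 0
      · have h1 : w 1 ≤ 0 := by
          by_contra! h1
          exact (hs fun _ => h1).1 hs0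
        have h2 := apply_ne_zero w one_ne_zero
        have hsw := isSignedSwap_mul_simpleReflection_zero w hs0
        rw [Finset.sum_eq_single_of_mem 1 (by rw [Finset.mem_Icc]; omega)]
        · rw [hsw.right, apply_neg]; omega
        · intro m hm hm1
          rw [Finset.mem_Icc] at hm
          rw [hsw.other m (by omega) (by omega) (by omega) (by omega), sub_self]
      · have h1 := (hs fun h => absurd h hs0).2
        have h2 : w (s + 1) ≠ w s := by rw [Ne, apply_inj]; omega
        have hsw := isSignedSwap_mul_simpleReflection_pos w hs0
        rw [Finset.sum_eq_add_of_mem (s : ℤ) (s + 1) (by rw [Finset.mem_Icc]; omega)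
          (by rw [Finset.mem_Icc]; omega) (by omega)]
        · rw [hsw.right, hsw.left]
          have : w (s + 1) < w s := by omega
          linarith
        · intro m hm hm1
          rw [Finset.mem_Icc] at hm
          rw [hsw.other m (by omega) (by omega) (by omega) (by omega), sub_self]
    obtain ⟨s, hs⟩ := hstep
    obtain ⟨ω, hω⟩ := ih (w * simpleReflection s) (by push_cast at hd; omega)
    refine ⟨ω ++ [s], ?_⟩
    rw [wordProd_append, wordProd_singleton, hω, mul_assoc, simpleReflection_mul_self, mul_one]

theorem exists_isReducedWordOf (w : hyperoctahedral n) : ∃ ω, IsReducedWordOf ω w := by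
  obtain ⟨ω, hω⟩ := exists_wordProd_eq w
  obtain ⟨ω', h1, h2⟩ := Nat.sInf_mem
    (s := {m | ∃ ω : List (Fin n), ω.length = m ∧ wordProd ω = w}) ⟨_, ω, rfl, hω⟩
  exact ⟨ω', h2, h1⟩

theorem signedLength_wordProd_le (ω : List (Fin n)) : signedLength (wordProd ω) ≤ ω.length :=
  Nat.sInf_le ⟨ω, rfl, rfl⟩

theorem signedLength_simpleReflection_mul_le (s : Fin n) (w : hyperoctahedral n) :
    signedLength (simpleReflection s * w) ≤ signedLength w + 1 := by
  obtain ⟨ω, hω, hlen⟩ := exists_isReducedWordOf w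
  have := signedLength_wordProd_le ([s] ++ ω)
  rw [wordProd_append, wordProd_singleton, hω, List.length_append, hlen, List.length_singleton] at this
  omega

variable {w w' : hyperoctahedral n} {i j : ℤ}

theorem signedLength_lt_of_isSignedSwap (h : IsSignedSwap w w' i j) (hij : i < j) (hi : i ≠ 0)
    (hj : j ≠ 0) (hinv : w j < w i) : signedLength w' < signedLength w := by
  obtain ⟨ω, rfl, hlen⟩ := exists_isReducedWordOf w
  obtain ⟨ω', -, hlen', rfl⟩ := exists_sublist_of_isSignedSwap ω hij hi hj h hinv
  have := signedLength_wordProd_le ω'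
  omega

theorem bruhatCovers_of_isSignedSwap (h : IsSignedSwap w w' i j) (hij : i < j) (hi : i ≠ 0)
    (hj : j ≠ 0) (hinv : w j < w i) (hle : signedLength w ≤ signedLength w' + 1) :
    BruhatCovers w w' := by
  refine ⟨?_, by have := signedLength_lt_of_isSignedSwap h hij hi hj hinv; omega⟩
  obtain ⟨ω, rfl, hlen⟩ := exists_isReducedWordOf w
  obtain ⟨ω', hsub, -, hprod⟩ := exists_sublist_of_isSignedSwap ω hij hi hj h hinv
  exact ⟨ω, ⟨rfl, hlen⟩, ω', hsub, hprod⟩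

/-- If `w` is longer than `w'`, the signed swap relating them removes an inversion of `w`. -/
theorem lt_of_isSignedSwap_of_signedLength_lt (h : IsSignedSwap w w' i j) (hij : i < j)
    (hi : i ≠ 0) (hj : j ≠ 0) (hlt : signedLength w' < signedLength w) : w j < w i := by
  rcases lt_trichotomy (w i) (w j) with h1 | h1 | h1
  · have := signedLength_lt_of_isSignedSwap h.symm hij hi hj (by rwa [h.left, h.right])
    omega
  · exact absurd ((apply_inj w).1 h1) hij.ne
  · exact h1

/-! ### Covers are reflections; bounding the drop in length -/

theorem List.Sublist.exists_eq_append_of_length_add_one {α : Type*} {l' l : List α}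
    (h : l'.Sublist l) (hlen : l'.length + 1 = l.length) :
    ∃ a s b, l = a ++ [s] ++ b ∧ l' = a ++ b := by
  induction h with
  | slnil => simp at hlen
  | @cons l₁ l₂ s h _ =>
    have : l₁ = l₂ := h.eq_of_length (by simpa using hlen)
    exact ⟨[], s, l₂, by simp, by simp [this]⟩
  | @cons_cons l₁ l₂ x h ih =>
    obtain ⟨a, s, b, rfl, rfl⟩ := ih (by simpa using hlen)
    exact ⟨x :: a, s, b, by simp, by simp⟩

/-- The lengths force the subword to omit exactly one letter `s` of `a s b`; the products of `a s b`
and `a b` differ by the reflection `s` conjugated by the product of `b`. -/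
theorem BruhatCovers.exists_isSignedSwap (h : BruhatCovers w w') :
    ∃ i j : ℤ, i ≠ 0 ∧ j ≠ 0 ∧ i ≠ j ∧ IsSignedSwap w w' i j := by
  obtain ⟨⟨ω, ⟨rfl, hred⟩, ω', hsub, rfl⟩, hlen⟩ := h
  have h1 := signedLength_wordProd_le ω'
  have h2 := hsub.length_le
  have h3 : ω'.length ≠ ω.length := by
    intro h3
    rw [hsub.eq_of_length h3] at hlen
    omega
  obtain ⟨a, s, b, rfl, rfl⟩ := hsub.exists_eq_append_of_length_add_one (by omega)
  rw [wordProd_append, wordProd_append, wordProd_append, wordProd_singleton]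
  have key : ∀ p q : ℤ, p ≠ 0 → q ≠ 0 → p ≠ q →
      IsSignedSwap (wordProd a) (wordProd a * simpleReflection s) p q →
      ∃ i j : ℤ, i ≠ 0 ∧ j ≠ 0 ∧ i ≠ j ∧
        IsSignedSwap (wordProd a * simpleReflection s * wordProd b) (wordProd a * wordProd b) i j := by
    intro p q hp hq hpq hsw
    obtain ⟨i, rfl⟩ := (wordProd b).1.surjective p
    obtain ⟨j, rfl⟩ := (wordProd b).1.surjective q
    refine ⟨i, j, ?_, ?_, ?_, hsw.symm.mul_right⟩
    · rintro rfl; exact hp (apply_zero _)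
    · rintro rfl; exact hq (apply_zero _)
    · rintro rfl; exact hpq rfl
  by_cases hs : (s : ℕ) = 0
  · exact key (-1) 1 (by norm_num) (by norm_num) (by norm_num)
      (isSignedSwap_mul_simpleReflection_zero _ hs)
  · exact key s (s + 1) (by omega) (by omega) (by omega)
      (isSignedSwap_mul_simpleReflection_pos _ hs)

/-- The reflections of type `B`: sign changes, and exchanges of two entries with or without a
change of both signs. -/
theorem BruhatCovers.cases (h : BruhatCovers w w') :
    (∃ j : ℤ, 0 < j ∧ j ≤ n ∧ IsSignedSwap w w' (-j) j) ∨
    (∃ i j : ℤ, 0 < i ∧ i < j ∧ j ≤ n ∧ IsSignedSwap w w' i j) ∨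
    (∃ i j : ℤ, 0 < i ∧ i < j ∧ j ≤ n ∧ IsSignedSwap w w' (-i) j) := by
  obtain ⟨i, j, hi, hj, hij, hsw⟩ := h.exists_isSignedSwap
  have bound : ∀ i j : ℤ, i ≠ j → IsSignedSwap w w' i j → |j| ≤ n := by
    intro i j hij hsw
    by_contra! hlt
    have h1 := hsw.right
    rw [apply_of_lt_abs w' hlt, ← apply_of_lt_abs w hlt, apply_inj] at h1
    exact hij h1.symm
  have hin := abs_le.1 (bound j i hij.symm hsw.comm)
  have hjn := abs_le.1 (bound i j hij hsw)
  have same : ∀ i j : ℤ, 0 < i → 0 < j → i ≠ j → i ≤ n → j ≤ n → IsSignedSwap w w' i j →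
      ∃ i j : ℤ, 0 < i ∧ i < j ∧ j ≤ n ∧ IsSignedSwap w w' i j := by
    intro i j hi hj hij hin hjn hsw
    rcases lt_or_gt_of_ne hij with hlt | hlt
    · exact ⟨i, j, hi, hlt, hjn, hsw⟩
    · exact ⟨j, i, hj, hlt, hin, hsw.comm⟩
  have opp : ∀ i j : ℤ, 0 < i → 0 < j → i ≤ n → j ≤ n → IsSignedSwap w w' (-i) j →
      (∃ j : ℤ, 0 < j ∧ j ≤ n ∧ IsSignedSwap w w' (-j) j) ∨
      ∃ i j : ℤ, 0 < i ∧ i < j ∧ j ≤ n ∧ IsSignedSwap w w' (-i) j := by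
    intro i j hi hj hin hjn hsw
    rcases lt_trichotomy i j with hlt | rfl | hlt
    · exact Or.inr ⟨i, j, hi, hlt, hjn, hsw⟩
    · exact Or.inl ⟨i, hi, hin, hsw⟩
    · exact Or.inr ⟨j, i, hj, hlt, hin, by simpa using hsw.neg.comm⟩
  rcases lt_or_gt_of_ne hi with hi' | hi' <;> rcases lt_or_gt_of_ne hj with hj' | hj'
  · exact Or.inr (Or.inl (same (-i) (-j) (by omega) (by omega) (by omega) (by omega) (by omega)
      hsw.neg))
  · rcases opp (-i) j (by omega) hj' (by omega) (by omega) (by simpa using hsw) with h | h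
    · exact Or.inl h
    · exact Or.inr (Or.inr h)
  · rcases opp (-j) i (by omega) hi' (by omega) (by omega) (by simpa using hsw.comm) with h | h
    · exact Or.inl h
    · exact Or.inr (Or.inr h)
  · exact Or.inr (Or.inl (same i j hi' hj' hij (by omega) (by omega) hsw))

/-- Exchanging the values `a > b > 0` changes the length by at most one if no value strictly between
them occurs in a position between theirs. -/
theorem signedLength_le_of_isSignedSwap {p q : ℤ} (d : ℕ) {a b : ℤ} (hab : a = b + 1 + d)
    (hb : 0 < b) (hpq : p < q) (hp : w p = a) (hq : w q = b) (h : IsSignedSwap w w' p q)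
    (hbetween : ∀ r, p < r → r < q → b < w r → ¬ w r < a) :
    signedLength w ≤ signedLength w' + 1 := by
  -- Values above `n` are fixed points; this makes `a - 1` a legitimate index of a simple
  -- reflection.
  have han : a ≤ n := by
    by_contra! hlt
    have h1 : w a = a := apply_of_lt_abs w (by rw [lt_abs]; omega)
    have h2 : p = a := (apply_inj w).1 (hp.trans h1.symm)
    have h3 : w q = q := apply_of_lt_abs w (by rw [lt_abs]; omega)
    omega
  obtain ⟨s, hs⟩ : ∃ s : Fin n, (s : ℤ) = a - 1 :=
    ⟨⟨(a - 1).toNat, by omega⟩, by simp only; omega⟩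
  have hs0 : (s : ℕ) ≠ 0 := by omega
  -- Here `d` counts the integers strictly between `b` and `a`. If there are none, the swap is left
  -- multiplication by a simple reflection. Otherwise left multiplication by `s`, which exchanges
  -- the values `a - 1` and `a`, lowers the larger value to `a - 1`.
  induction d generalizing w w' a s with
  | zero =>
    have hsw := (isSignedSwap_simpleReflection_pos_mul hs0 (w := w) (p := q) (q := p)
      (by push_cast at hab; omega) (by omega)).comm
    rw [h.unique hsw]
    have := signedLength_simpleReflection_mul_le s (simpleReflection s * w)
    rwa [← mul_assoc, simpleReflection_mul_self, one_mul] at this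
  | succ d ih =>
    push_cast at hab
    obtain ⟨s', hs'⟩ : ∃ s : Fin n, (s : ℤ) = a - 1 - 1 :=
      ⟨⟨(a - 1 - 1).toNat, by omega⟩, by simp only; omega⟩
    obtain ⟨r, hr⟩ := w.1.surjective (a - 1)
    change w r = a - 1 at hr
    have hr0 : r ≠ 0 := by
      rintro rfl
      rw [apply_zero] at hr
      omega
    have hp0 : p ≠ 0 := by
      rintro rfl
      rw [apply_zero] at hp
      omega
    have hq0 : q ≠ 0 := by
      rintro rfl
      rw [apply_zero] at hq
      omega
    have hrp : r ≠ p := by rintro rfl; omega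
    have hrq : r ≠ q := by rintro rfl; omega
    have hrp' : r ≠ -p := by rintro rfl; rw [apply_neg] at hr; omega
    have hrq' : r ≠ -q := by rintro rfl; rw [apply_neg] at hr; omega
    have hr' : w' r = a - 1 := by rw [h.other r hrp hrp' hrq hrq', hr]
    have hsw : IsSignedSwap w (simpleReflection s * w) r p :=
      isSignedSwap_simpleReflection_pos_mul hs0 (by omega) (by omega)
    have hsw' : IsSignedSwap w' (simpleReflection s * w') r q :=
      isSignedSwap_simpleReflection_pos_mul hs0 (by omega) (by rw [h.right]; omega)
    have hih : signedLength (simpleReflection s * w) ≤ signedLength (simpleReflection s * w') + 1 := by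
      refine ih (a := a - 1) (by omega) ?_ ?_ (h.mul_left _) ?_ (by omega) s' hs' (by omega)
      · rw [hsw.right, hr]
      · rw [mul_apply, hq, simpleReflection_pos_apply hs0]
        split_ifs <;> omega
      · intro m hm1 hm2
        have hm := hbetween m hm1 hm2
        rw [mul_apply, simpleReflection_pos_apply hs0]
        split_ifs <;> omega
    -- The value `a - 1` cannot lie between `p` and `q`. To the left of `p`, `s` lengthens `w`; to
    -- the right of `q`, `s` shortens `w'`. Either gain, with a change of at most one for the other
    -- element, carries the bound back from `s * w` and `s * w'`.
    rcases lt_trichotomy r p with hlt | heq | hgt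
    · have h1 := signedLength_lt_of_isSignedSwap hsw.symm hlt hr0 hp0
        (by rw [hsw.left, hsw.right]; omega)
      have h2 := signedLength_simpleReflection_mul_le s w'
      omega
    · exact absurd heq hrp
    · have hrq2 : q < r := by
        by_contra! hle
        exact hbetween r hgt (lt_of_le_of_ne hle hrq) (by omega) (by omega)
      have h1 := signedLength_lt_of_isSignedSwap hsw'.comm hrq2 hq0 hr0
        (by rw [h.right]; omega)
      have h2 := signedLength_simpleReflection_mul_le s (simpleReflection s * w)
      rw [← mul_assoc, simpleReflection_mul_self, one_mul] at h2
      omega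

end Word

/-! ### Shape of Grassmannian permutations, and the four changes as covers -/

section Grassmannian

variable {n k : ℕ} {w w' : hyperoctahedral n}

theorem apply_lt_apply_succ_of_mem_grassmannianPerms (hw : w ∈ grassmannianPerms n k) {i : ℕ}
    (h1 : 1 ≤ i) (hin : i < n) (hik : i ≠ k) : w i < w (i + 1) := by
  by_contra! hle
  have h2 := hw ⟨i, hin⟩ hik
  have h3 : w (i : ℤ) ≠ w (i + 1) := by rw [Ne, apply_inj]; omega
  have hsw := isSignedSwap_mul_simpleReflection_pos w (i := ⟨i, hin⟩) (by simp only; omega)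
  have := signedLength_lt_of_isSignedSwap hsw (by simp) (by simp only; omega) (by simp only; omega)
    (by simp only; omega)
  omega

theorem apply_lt_apply_of_mem_grassmannianPerms (hw : w ∈ grassmannianPerms n k) {i j : ℤ}
    (hi : 1 ≤ i) (hij : i < j) (hj : j ≤ n) (hk : j ≤ k ∨ k < i) : w i < w j := by
  obtain ⟨i, rfl⟩ := Int.eq_ofNat_of_zero_le (show 0 ≤ i by omega)
  obtain ⟨j, rfl⟩ := Int.eq_ofNat_of_zero_le (show 0 ≤ j by omega)
  have hij' : i + 1 ≤ j := by omega
  clear hij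
  induction j, hij' using Nat.le_induction with
  | base =>
    have := apply_lt_apply_succ_of_mem_grassmannianPerms hw (i := i) (by omega) (by omega) (by omega)
    exact_mod_cast this
  | succ j hle ih =>
    have h1 := ih (by omega) (by omega)
    have h2 := apply_lt_apply_succ_of_mem_grassmannianPerms hw (i := j) (by omega) (by omega)
      (by omega)
    push_cast
    exact h1.trans h2

theorem apply_pos_of_mem_grassmannianPerms (hw : w ∈ grassmannianPerms n k) (hk : k ≤ n) {i : ℤ}
    (hi : 1 ≤ i) (hik : i ≤ k) : 0 < w i := by
  have h1 : 0 < w 1 := by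
    by_contra! hle
    -- From `1 ≤ i ≤ k` one gets `k ≠ 0`, so the Grassmannian condition applies to `s_0`.
    have h2 := hw ⟨0, by omega⟩ (by simp only; omega)
    have h3 := apply_ne_zero w one_ne_zero
    have hsw := isSignedSwap_mul_simpleReflection_zero w (i := ⟨0, by omega⟩) rfl
    have := signedLength_lt_of_isSignedSwap hsw (by norm_num) (by norm_num) (by norm_num)
      (by rw [apply_neg]; omega)
    omega
  rcases hi.eq_or_lt with rfl | hlt
  · exact h1
  · exact h1.trans (apply_lt_apply_of_mem_grassmannianPerms hw le_rfl hlt (by omega) (Or.inl hik))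

theorem bruhatCovers_of_isTypeB1 (h : IsTypeB1 k w w') : BruhatCovers w w' := by
  obtain ⟨j, ⟨hj1, hj2⟩, hwj, hwj', hoth⟩ := h
  have hsw : IsSignedSwap w w' (-j) j :=
    .of_eqOn (by rw [apply_neg]; omega) (by rw [apply_neg]; omega) fun m hm h1 h2 =>
      hoth m hm (by rwa [abs_of_pos (by omega)] at h2)
  refine bruhatCovers_of_isSignedSwap hsw (by omega) (by omega) (by omega)
    (by rw [apply_neg]; omega) ?_
  have hsw' := isSignedSwap_simpleReflection_zero_mul (i := ⟨0, by omega⟩) rfl (w := w) (p := -j)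
    (by rw [apply_neg]; omega)
  rw [neg_neg] at hsw'
  rw [hsw.unique hsw']
  have := signedLength_simpleReflection_mul_le ⟨0, by omega⟩
    (simpleReflection ⟨0, by omega⟩ * w)
  rwa [← mul_assoc, simpleReflection_mul_self, one_mul] at this

theorem bruhatCovers_of_isTypeB2 (h : IsTypeB2 k w w') : BruhatCovers w w' := by
  obtain ⟨a, ha, i, ⟨hi1, hi2⟩, j, ⟨hj1, hj2⟩, hij, hwi, hwj, hwi', hwj', hoth⟩ := h
  have hsw : IsSignedSwap w w' (-i) j :=
    .of_eqOn (by rw [apply_neg]; omega) (by rw [apply_neg]; omega) fun m hm h1 h2 =>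
      hoth m hm (by rwa [abs_neg, abs_of_pos (by omega)] at h1)
        (by rwa [abs_of_pos (by omega)] at h2)
  refine bruhatCovers_of_isSignedSwap hsw (by omega) (by omega) (by omega)
    (by rw [apply_neg]; omega) ?_
  exact signedLength_le_of_isSignedSwap 0 (a := a) (by push_cast; omega) ha (by omega)
    (by rw [apply_neg]; omega) hwj hsw (fun r _ _ h1 h2 => by omega)

theorem bruhatCovers_of_isTypeB3 (hw : w ∈ grassmannianPerms n k)
    (h : IsTypeB3 k w w') : BruhatCovers w w' := by
  obtain ⟨a, x, hx, hxa, i, ⟨hi1, hi2⟩, j, ⟨hj1, hj2⟩, hwi, hwj, hwi', hwj', hoth⟩ := h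
  have hsw : IsSignedSwap w w' i j :=
    .of_eqOn (by omega) (by omega) fun m hm h1 h2 =>
      hoth m hm (by rwa [abs_of_pos (by omega)] at h1) (by rwa [abs_of_pos (by omega)] at h2)
  refine bruhatCovers_of_isSignedSwap hsw (by omega) (by omega) (by omega) (by omega) ?_
  refine signedLength_le_of_isSignedSwap (x - 1).toNat (a := a) (b := a - x) (by omega) (by omega)
    (by omega) hwi hwj hsw fun r hr1 hr2 h1 h2 => ?_
  -- Positions after `i` in the first block carry values above `a`; positions before `j` in the
  -- second carry values below `a - x`.
  rcases le_or_gt r k with hr | hr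
  · have := apply_lt_apply_of_mem_grassmannianPerms hw hi1 hr1 (by omega) (Or.inl hr)
    omega
  · have := apply_lt_apply_of_mem_grassmannianPerms hw (by omega) hr2 hj2 (Or.inr hr)
    omega

theorem bruhatCovers_of_isTypeB4 (hk : k ≤ n) (hw : w ∈ grassmannianPerms n k)
    (h : IsTypeB4 k w w') : BruhatCovers w w' := by
  obtain ⟨a, x, hx, hxa, i, ⟨hi1, hi2⟩, j, ⟨hj1, hj2⟩, hwi, hwj, hwi', hwj', hoth⟩ := h
  have hsw : IsSignedSwap w w' (-j) i :=
    .of_eqOn (by rw [apply_neg]; omega) (by rw [apply_neg]; omega) fun m hm h1 h2 =>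
      hoth m hm (by rwa [abs_of_pos (by omega)] at h2)
        (by rwa [abs_neg, abs_of_pos (by omega)] at h1)
  refine bruhatCovers_of_isSignedSwap hsw (by omega) (by omega) (by omega)
    (by rw [apply_neg]; omega) ?_
  refine signedLength_le_of_isSignedSwap (x - 1).toNat (a := a) (b := a - x) (by omega) (by omega)
    (by omega) (by rw [apply_neg]; omega) hwi hsw fun r hr1 hr2 h1 h2 => ?_
  -- For `r < 0`, either `-r` is in the first block and `w r` is negative, or `-r` precedes `j` in
  -- the second block and `w r > a`. For `0 < r < i`, the value is below `a - x`.
  rcases lt_trichotomy r 0 with hr | rfl | hr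
  · have hneg := apply_neg w r
    rcases le_or_gt (-r) k with hrk | hrk
    · have := apply_pos_of_mem_grassmannianPerms hw hk (i := -r) (by omega) hrk
      omega
    · have := apply_lt_apply_of_mem_grassmannianPerms hw (i := -r) (j := j) (by omega) (by omega)
        hj2 (Or.inr hrk)
      omega
  · rw [apply_zero] at h1
    omega
  · have := apply_lt_apply_of_mem_grassmannianPerms hw (i := r) (j := i) (by omega) hr2
      (by omega) (Or.inl hi2)
    omega

/-! ### Every Grassmannian cover is one of the four changes -/

/-- A value `c` such that neither `c` nor `-c` is an entry of the second block occurs in the first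
block. -/
theorem exists_pos_le_apply_eq (hk : k ≤ n) (hw : w ∈ grassmannianPerms n k) {c : ℤ} (hc : 0 < c)
    (hcn : c ≤ n) (hv : ∀ m : ℤ, k < m → m ≤ n → w m ≠ c) (hl : ∀ m : ℤ, k < m → m ≤ n → w m ≠ -c) :
    ∃ m : ℤ, 1 ≤ m ∧ m ≤ k ∧ w m = c := by
  obtain ⟨m, hmn, hm⟩ := exists_apply_eq w (a := c) (by rw [abs_of_pos hc]; exact hcn)
  rw [abs_le] at hmn
  rcases lt_trichotomy m 0 with h0 | rfl | h0
  · have hneg := apply_neg w m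
    rcases le_or_gt (-m) k with hmk | hmk
    · have := apply_pos_of_mem_grassmannianPerms hw hk (i := -m) (by omega) hmk
      omega
    · exact absurd (by omega) (hl (-m) hmk (by omega))
  · rw [apply_zero] at hm
    omega
  · rcases le_or_gt m k with hmk | hmk
    · exact ⟨m, by omega, hmk, hm⟩
    · exact absurd hm (hv m hmk (by omega))

theorem isTypeB1_of_bruhatCovers (hk : k ≤ n) (hw : w ∈ grassmannianPerms n k)
    (hw' : w' ∈ grassmannianPerms n k) (h : BruhatCovers w w') {j : ℤ} (hj : 0 < j) (hjn : j ≤ n)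
    (hsw : IsSignedSwap w w' (-j) j) : IsTypeB1 k w w' := by
  have hlen := h.2
  have hinv := lt_of_isSignedSwap_of_signedLength_lt hsw (by omega) (by omega) (by omega)
    (by omega)
  have hneg := apply_neg w j
  have hjk : k < j := by
    by_contra! hle
    have := apply_pos_of_mem_grassmannianPerms hw hk (i := j) (by omega) hle
    omega
  have hright := hsw.right
  have hother : ∀ m : ℤ, 0 < m → m ≠ j → w' m = w m := fun m hm hmj =>
    hsw.other m (by omega) (by omega) (by omega) (by omega)
  suffices hone : w j = -1 from
    ⟨j, ⟨by omega, hjn⟩, hone, by omega, fun m hm hmj => hother m (by have := hm.1; omega) hmj⟩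
  by_contra hne
  -- No second-block entry is smaller than `-w j` in absolute value: use monotonicity of `w` before
  -- `j` and of `w'` after it. If `w j ≠ -1`, the value 1 must then lie in the first block.
  have hfirst : ∀ m : ℤ, k < m → m ≤ n → w m ≤ w j ∨ -w j < w m := by
    intro m hmk hmn
    rcases lt_trichotomy m j with hlt | rfl | hlt
    · exact Or.inl (apply_lt_apply_of_mem_grassmannianPerms hw (by omega) hlt hjn (Or.inr hmk)).le
    · exact Or.inl le_rfl
    · have := apply_lt_apply_of_mem_grassmannianPerms hw' (by omega) hlt hmn (Or.inr hjk)
      rw [hother m (by omega) (by omega)] at this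
      exact Or.inr (by omega)
  obtain ⟨m, hm1, hmk, hm⟩ := exists_pos_le_apply_eq hk hw (c := 1) one_pos (by omega)
    (fun m hmk hmn => by have := hfirst m hmk hmn; omega)
    (fun m hmk hmn => by have := hfirst m hmk hmn; omega)
  have hmn := apply_neg w m
  -- With `a = -w j`, the entries at `(m, j)` run through `(1, -a)`, `(a, -1)`, `(a, 1)`, `(1, a)`,
  -- and each step removes an inversion.
  obtain ⟨w₁, h₁⟩ := exists_isSignedSwap w (i := -m) (j := j) (by rw [abs_le]; omega)
    (by rw [abs_le]; omega) (by omega) (by omega)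
  have l₁ := signedLength_lt_of_isSignedSwap h₁ (by omega) (by omega) (by omega) (by omega)
  have h₁l := h₁.left
  have h₁r := h₁.right
  rw [apply_neg] at h₁l
  have hneg₁ := apply_neg w₁ j
  obtain ⟨w₂, h₂⟩ := exists_isSignedSwap w₁ (i := -j) (j := j) (by rw [abs_le]; omega)
    (by rw [abs_le]; omega) (by omega) (by omega)
  have l₂ := signedLength_lt_of_isSignedSwap h₂ (by omega) (by omega) (by omega) (by omega)
  have h₂r := h₂.right
  have h₂m := h₂.other m (by omega) (by omega) (by omega) (by omega)
  have h₃ : IsSignedSwap w₂ w' m j := by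
    refine ⟨?_, by omega, fun r hr1 hr2 hr3 hr4 => ?_⟩
    · rw [hother m (by omega) (by omega)]
      omega
    · rw [hsw.other r (by omega) (by omega) (by omega) (by omega),
        h₂.other r (by omega) (by omega) (by omega) (by omega),
        h₁.other r (by omega) (by omega) (by omega) (by omega)]
  have l₃ := signedLength_lt_of_isSignedSwap h₃ (by omega) (by omega) (by omega) (by omega)
  omega

/-- An inversion of `w` at positive positions must straddle the blocks, and the smaller value is
positive because it lands in the first block of `w'`. -/
theorem isTypeB3_of_bruhatCovers (hk : k ≤ n) (hw : w ∈ grassmannianPerms n k)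
    (hw' : w' ∈ grassmannianPerms n k) (h : BruhatCovers w w') {i j : ℤ} (hi : 0 < i) (hij : i < j)
    (hjn : j ≤ n) (hsw : IsSignedSwap w w' i j) : IsTypeB3 k w w' := by
  have hlen := h.2
  have hinv := lt_of_isSignedSwap_of_signedLength_lt hsw hij (by omega) (by omega) (by omega)
  have hblock : i ≤ k ∧ k < j := by
    by_contra hnot
    have := apply_lt_apply_of_mem_grassmannianPerms hw (by omega) hij hjn (by omega)
    omega
  have hpos := apply_pos_of_mem_grassmannianPerms hw' hk (i := i) (by omega) hblock.1
  rw [hsw.left] at hpos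
  exact ⟨w i, w i - w j, by omega, by omega, i, ⟨by omega, hblock.1⟩, j, ⟨by omega, hjn⟩, rfl,
    by omega, by rw [hsw.left]; omega, hsw.right, fun m hm hmi hmj =>
      hsw.other m hmi (by have := hm.1; omega) hmj (by have := hm.1; omega)⟩

theorem isTypeB2_of_bruhatCovers (hk : k ≤ n) (hw : w ∈ grassmannianPerms n k)
    (hw' : w' ∈ grassmannianPerms n k) (h : BruhatCovers w w') {i j : ℤ} (hik : k < i) (hij : i < j)
    (hjn : j ≤ n) (hsw : IsSignedSwap w w' (-i) j) : IsTypeB2 k w w' := by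
  have hlen := h.2
  have hinv := lt_of_isSignedSwap_of_signedLength_lt hsw (by omega) (by omega) (by omega) (by omega)
  have hinc := apply_lt_apply_of_mem_grassmannianPerms hw (by omega) hij hjn (Or.inr hik)
  have hwi := apply_neg w i
  have hwj := apply_neg w j
  have hleft := hsw.left
  have hright := hsw.right
  rw [apply_neg] at hleft
  have hother : ∀ m : ℤ, 0 < m → m ≠ i → m ≠ j → w' m = w m := fun m hm hmi hmj =>
    hsw.other m (by omega) (by omega) (by omega) (by omega)
  have hjpos : 0 < w j := by
    by_contra! hle
    have hj0 := apply_ne_zero w (i := j) (by omega)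
    -- If both entries are negative, changing the sign at `j`, then at `i`, then exchanging the two
    -- is a chain of three drops.
    obtain ⟨w₁, h₁⟩ := exists_isSignedSwap w (i := -j) (j := j) (by rw [abs_le]; omega)
      (by rw [abs_le]; omega) (by omega) (by omega)
    have l₁ := signedLength_lt_of_isSignedSwap h₁ (by omega) (by omega) (by omega) (by omega)
    have h₁j := h₁.right
    have h₁i := h₁.other i (by omega) (by omega) (by omega) (by omega)
    have hneg₁ := apply_neg w₁ i
    obtain ⟨w₂, h₂⟩ := exists_isSignedSwap w₁ (i := -i) (j := i) (by rw [abs_le]; omega)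
      (by rw [abs_le]; omega) (by omega) (by omega)
    have l₂ := signedLength_lt_of_isSignedSwap h₂ (by omega) (by omega) (by omega) (by omega)
    have h₂i := h₂.right
    have h₂j := h₂.other j (by omega) (by omega) (by omega) (by omega)
    have h₃ : IsSignedSwap w₂ w' i j := by
      refine ⟨by omega, by omega, fun r hr1 hr2 hr3 hr4 => ?_⟩
      rw [hsw.other r (by omega) (by omega) (by omega) (by omega),
        h₂.other r (by omega) (by omega) (by omega) (by omega),
        h₁.other r (by omega) (by omega) (by omega) (by omega)]
    have l₃ := signedLength_lt_of_isSignedSwap h₃ (by omega) (by omega) (by omega) (by omega)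
    omega
  suffices hadj : w j = -w i - 1 from
    ⟨-w i, by omega, i, ⟨by omega, by omega⟩, j, ⟨by omega, hjn⟩, hij, by omega, by omega, by omega,
      by omega, fun m hm hmi hmj => hother m (by have := hm.1; omega) hmi hmj⟩
  by_contra hne
  have hwin := abs_le.1 (abs_apply_le w (i := i) (by rw [abs_le]; omega))
  -- Put `a = -w i` and `b = w j`, so `b < a - 1`. Monotonicity of `w` and `w'` keeps `±(a - 1)` out
  -- of the second block, so `a - 1` lies in the first.
  have hv : ∀ m : ℤ, k < m → m ≤ n → w m ≠ -w i - 1 := by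
    intro m hmk hmn hm
    have hmi : m ≠ i := by rintro rfl; omega
    have hmj : m ≠ j := by rintro rfl; omega
    have hm' := hother m (by omega) hmi hmj
    rcases lt_or_gt_of_ne hmj with hlt | hlt
    · have := apply_lt_apply_of_mem_grassmannianPerms hw (by omega) hlt hjn (Or.inr hmk)
      omega
    · have := apply_lt_apply_of_mem_grassmannianPerms hw' (by omega) hlt hmn (Or.inr (by omega))
      omega
  have hl : ∀ m : ℤ, k < m → m ≤ n → w m ≠ -(-w i - 1) := by
    intro m hmk hmn hm
    have hmi : m ≠ i := by rintro rfl; omega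
    have hmj : m ≠ j := by rintro rfl; omega
    have hm' := hother m (by omega) hmi hmj
    rcases lt_or_gt_of_ne hmi with hlt | hlt
    · have := apply_lt_apply_of_mem_grassmannianPerms hw (by omega) hlt (by omega) (Or.inr hmk)
      omega
    · have := apply_lt_apply_of_mem_grassmannianPerms hw' (by omega) hlt hmn (Or.inr hik)
      omega
  obtain ⟨m, hm1, hmk, hm⟩ := exists_pos_le_apply_eq hk hw (by omega) (by omega) hv hl
  have hmn := apply_neg w m
  -- The entries at `(m, i, j)` run through `(a-1, -a, b)`, `(a, -(a-1), b)`, `(b, -(a-1), a)`,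
  -- `(a-1, -b, a)`: three drops.
  obtain ⟨w₁, h₁⟩ := exists_isSignedSwap w (i := -m) (j := i) (by rw [abs_le]; omega)
    (by rw [abs_le]; omega) (by omega) (by omega)
  have l₁ := signedLength_lt_of_isSignedSwap h₁ (by omega) (by omega) (by omega) (by omega)
  have h₁m := h₁.left
  have h₁i := h₁.right
  have h₁j := h₁.other j (by omega) (by omega) (by omega) (by omega)
  rw [apply_neg] at h₁m
  obtain ⟨w₂, h₂⟩ := exists_isSignedSwap w₁ (i := m) (j := j) (by rw [abs_le]; omega)
    (by rw [abs_le]; omega) (by omega) (by omega)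
  have l₂ := signedLength_lt_of_isSignedSwap h₂ (by omega) (by omega) (by omega) (by omega)
  have h₂m := h₂.left
  have h₂j := h₂.right
  have h₂i := h₂.other i (by omega) (by omega) (by omega) (by omega)
  have hneg₂ := apply_neg w₂ m
  have hm' := hother m (by omega) (by omega) (by omega)
  have h₃ : IsSignedSwap w₂ w' (-m) i := by
    refine ⟨by rw [apply_neg]; omega, by omega, fun r hr1 hr2 hr3 hr4 => ?_⟩
    by_cases hrj : r = j
    · rw [hrj]; omega
    by_cases hrj' : r = -j
    · rw [hrj', apply_neg, apply_neg]; omega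
    rw [hsw.other r (by omega) (by omega) (by omega) (by omega),
      h₂.other r (by omega) (by omega) (by omega) (by omega),
      h₁.other r (by omega) (by omega) (by omega) (by omega)]
  have l₃ := signedLength_lt_of_isSignedSwap h₃ (by omega) (by omega) (by omega) (by omega)
  omega

theorem isTypeB4_of_bruhatCovers (hk : k ≤ n) (hw : w ∈ grassmannianPerms n k)
    (h : BruhatCovers w w') {i j : ℤ} (hi : 0 < i) (hik : i ≤ k)
    (hij : i < j) (hjn : j ≤ n) (hsw : IsSignedSwap w w' (-i) j) : IsTypeB4 k w w' := by
  have hlen := h.2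
  have hinv := lt_of_isSignedSwap_of_signedLength_lt hsw (by omega) (by omega) (by omega) (by omega)
  have hwi := apply_neg w i
  have hipos := apply_pos_of_mem_grassmannianPerms hw hk (i := i) (by omega) hik
  have hjk : k < j := by
    by_contra! hle
    have := apply_pos_of_mem_grassmannianPerms hw hk (i := j) (by omega) hle
    omega
  have hleft := hsw.left
  have hright := hsw.right
  rw [apply_neg] at hleft
  exact ⟨-w j, -w j - w i, by omega, by omega, i, ⟨by omega, hik⟩, j, ⟨by omega, hjn⟩, by omega,
    by omega, by omega, by omega, fun m hm hmi hmj => by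
      have := hm.1
      exact hsw.other m (by omega) (by omega) (by omega) (by omega)⟩

end Grassmannian

theorem theorem2p2 (n k : ℕ) (hk : k ≤ n) (w w' : hyperoctahedral n)
    (hw : w ∈ grassmannianPerms n k) (hw' : w' ∈ grassmannianPerms n k) :
    BruhatCovers w w' ↔
      IsTypeB1 k w w' ∨ IsTypeB2 k w w' ∨ IsTypeB3 k w w' ∨ IsTypeB4 k w w' := by
  constructor
  · intro h
    rcases h.cases with ⟨j, hj, hjn, hsw⟩ | ⟨i, j, hi, hij, hjn, hsw⟩ | ⟨i, j, hi, hij, hjn, hsw⟩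
    · exact Or.inl (isTypeB1_of_bruhatCovers hk hw hw' h hj hjn hsw)
    · exact Or.inr (Or.inr (Or.inl (isTypeB3_of_bruhatCovers hk hw hw' h hi hij hjn hsw)))
    · rcases le_or_gt i k with hik | hik
      · exact Or.inr (Or.inr (Or.inr (isTypeB4_of_bruhatCovers hk hw h hi hik hij hjn hsw)))
      · exact Or.inr (Or.inl (isTypeB2_of_bruhatCovers hk hw hw' h hik hij hjn hsw))
  · rintro (h | h | h | h)
    · exact bruhatCovers_of_isTypeB1 h
    · exact bruhatCovers_of_isTypeB2 h
    · exact bruhatCovers_of_isTypeB3 hw h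
    · exact bruhatCovers_of_isTypeB4 hk hw h
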